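/- Let $m\ge 0$ and let $l_1,\dots,l_m\ge 1$ be integers. There is an integer $L$, depending only on $m$ and $l_1,\dots,l_m$, such that the following holds for every integer $l>m$ with $l\ge L$. Let $p$ be a real-valued real analytic function germ at $0\in\mathbb{C}^m$ whose $l$-jet at $0$ is $\sum_{i=1}^m |w_i|^{2l_i}$. Let $n\ge 1$, let $a_i\ge 1$ and $b_i\ge 0$ $(i=1,\dots,n)$ be integers, with the variables numbered so that $a_1+2b_1\le\dots\le a_n+2b_n$, and put $d=\operatorname{lcm}_i(a_i+2b_i)$ and $r_i=d/(a_i+2b_i)$. Let $q_i(z,\bar z)=|z_i|^{2b_i}+\tilde q_i(z,\bar z)$, where each $\tilde q_i$ is a real-valued polynomial in $z_1,\dots,z_n,\bar z_1,\dots,\bar z_n$ all of whose monomials have weight at least $d-r_n+r_1$; here $z_j$ and $\bar z_j$ have weight $r_j$. Set $$f(w,z)=p(w,\bar w)+\sum_{i=1}^n z_i^{a_i}q_i(z,\bar z),\quad h(w,z)=\sum_{i=1}^m|w_i|^{2l_i}+\sum_{i=1}^n z_i^{a_i+b_i}\bar z_i^{\,b_i},\quad g(w,z)=\sum_{i=1}^m|w_i|^{2l_i}+\sum_{i=1}^n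 z_i^{a_i},$$ regarded as germs $(\mathbb{C}^m\times\mathbb{C}^n,0)\to(\mathbb{C},0)$. Call two such germs $F,G$ topologically (respectively bi-Lipschitz) equivalent if $F=G\circ\phi$ for a germ $\phi$ at $0$ of a homeomorphism (respectively a homeomorphism that is Lipschitz with Lipschitz inverse) of $\mathbb{C}^m\times\mathbb{C}^n$ fixing $0$. Then: 1. $f$ is bi-Lipschitz equivalent to $h$; 2. $h$ is topologically equivalent to $g$; 3. if $a_i=1$ for some $i$ (in particular, if $a_1=1$), then $f$ is a topological submersion, that is, topologically equivalent to the germ at $0$ of a smooth submersion $\mathbb{C}^m\times\mathbb{C}^n\to\mathbb{C}$ of real manifolds. -/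

import Mathlib

open scoped ContDiff ComplexConjugate

noncomputable section

namespace MixedGerm

/-- Topological (right) equivalence of the germs at `0` of `f` and `g`: there is a germ of
homeomorphism `φ : (E, 0) → (E, 0)` with `g ∘ φ = f`. -/
def TopEquiv {E F : Type*} [TopologicalSpace E] [Zero E] (f g : E → F) : Prop :=
  ∃ φ : OpenPartialHomeomorph E E,
    (0 : E) ∈ φ.source ∧ φ 0 = 0 ∧ ∀ x ∈ φ.source, g (φ x) = f x

/-- Bi-Lipschitz (right) equivalence of the germs at `0` of `f` and `g`: there is a germ of
homeomorphism `φ : (E, 0) → (E, 0)`, Lipschitz with Lipschitz inverse, such that `g ∘ φ = f`.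
On a finite-dimensional space this does not depend on the choice of the norm. -/
def BiLipEquiv {E F : Type*} [PseudoEMetricSpace E] [Zero E] (f g : E → F) : Prop :=
  ∃ φ : OpenPartialHomeomorph E E,
    (0 : E) ∈ φ.source ∧ φ 0 = 0 ∧ (∀ x ∈ φ.source, g (φ x) = f x) ∧
      ∃ K : NNReal, LipschitzOnWith K φ φ.source ∧ LipschitzOnWith K φ.symm φ.target

/-- The germ of `f` at `0` is a topological submersion: it is topologically equivalent to the
germ at `0` of a smooth submersion. -/
def IsTopSubmersion {E F : Type*} [NormedAddCommGroup E] [NormedSpace ℝ E]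
    [NormedAddCommGroup F] [NormedSpace ℝ F] (f : E → F) : Prop :=
  ∃ s : E → F, TopEquiv f s ∧
    ∃ U : Set E, IsOpen U ∧ (0 : E) ∈ U ∧ ContDiffOn ℝ ∞ s U ∧
      ∀ x ∈ U, Function.Surjective (fderiv ℝ s x)

/-- `f` and `g` have the same `l`-jet at `0`. -/
def SameJet {E F : Type*} [NormedAddCommGroup E] [NormedSpace ℝ E]
    [NormedAddCommGroup F] [NormedSpace ℝ F] (l : ℕ) (f g : E → F) : Prop :=
  ∀ k ≤ l, iteratedFDeriv ℝ k f 0 = iteratedFDeriv ℝ k g 0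

/-- Mixed polynomials in `n` variables: polynomials in `z_i` (the variables `Sum.inl i`) and
in the conjugates of the `z_i` (the variables `Sum.inr i`), with complex coefficients. -/
abbrev MixedPoly (n : ℕ) : Type := MvPolynomial (Fin n ⊕ Fin n) ℂ

/-- The value of a mixed polynomial at the point `z`. -/
def MixedPoly.evalAt {n : ℕ} (P : MixedPoly n) (z : Fin n → ℂ) : ℂ :=
  MvPolynomial.eval (Sum.elim z fun i => conj (z i)) P

/-- A mixed polynomial is real if it takes only real values. -/
def MixedPoly.IsReal {n : ℕ} (P : MixedPoly n) : Prop :=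
  ∀ z : Fin n → ℂ, (P.evalAt z).im = 0

/-- The filtration of a mixed polynomial with respect to the weights `r`, where the complex
variable `z_i` (equivalently, both of its real coordinates, or `z_i` and its conjugate) has
weight `r i`: the smallest weight of a monomial that occurs, and `⊤` for the zero polynomial.
Passing from `z_i` and its conjugate to the real and imaginary parts of `z_i` is a linear
substitution between variables of equal weight, so it does not change this number. -/
def MixedPoly.filtration {n : ℕ} (r : Fin n → ℕ) (P : MixedPoly n) : ℕ∞ :=
  ⨅ s ∈ P.support, ((∑ i, r i * (s (Sum.inl i) + s (Sum.inr i)) : ℕ) : ℕ∞)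

/-- The function `∑ |w_i|^(2 l_i)`. -/
def normForm {m : ℕ} (e : Fin m → ℕ) (w : Fin m → ℂ) : ℝ :=
  ∑ i, ‖w i‖ ^ (2 * e i)

/-- The mixed Pham-Brieskorn polynomial `f_{a,b}`. -/
def mixedPB {n : ℕ} (a b : Fin n → ℕ) (z : Fin n → ℂ) : ℂ :=
  ∑ i, z i ^ (a i + b i) * conj (z i) ^ b i

/-- The Pham-Brieskorn polynomial `g_a`. -/
def phamBrieskorn {n : ℕ} (a : Fin n → ℕ) (z : Fin n → ℂ) : ℂ :=
  ∑ i, z i ^ a i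

/-- `d = lcm (a_i + 2 b_i)`. -/
def wdeg {n : ℕ} (a b : Fin n → ℕ) : ℕ :=
  Finset.univ.lcm fun i => a i + 2 * b i

/-- `r_i = d / (a_i + 2 b_i)`; the division is exact. -/
def weight {n : ℕ} (a b : Fin n → ℕ) (i : Fin n) : ℕ :=
  wdeg a b / (a i + 2 * b i)

/-- The sum `F(w) + G(z)` of functions of separate variables. -/
def directSum {m n : ℕ} (F : (Fin m → ℂ) → ℝ) (G : (Fin n → ℂ) → ℂ)
    (x : (Fin m → ℂ) × (Fin n → ℂ)) : ℂ :=
  (F x.1 : ℂ) + G x.2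

/-- The function `∑ z_i^{a_i} q_i` with `q_i = |z_i|^{2 b_i} + q̃_i`. -/
def deformedPB {n : ℕ} (a b : Fin n → ℕ) (q : Fin n → MixedPoly n) (z : Fin n → ℂ) : ℂ :=
  ∑ i, z i ^ a i * ((‖z i‖ : ℂ) ^ (2 * b i) + (q i).evalAt z)

end MixedGerm

end

open scoped ContDiff ComplexConjugate
open Filter Topology Asymptotics

noncomputable section

namespace MixedGerm

/-! ### Maps close to the identity -/

/-! No vector field is integrated: the changes of coordinates are written down explicitly. The
variables separate, so `w` and `z` are treated independently, and a product of maps close to the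
identity is again one, hence bi-Lipschitz (`NearId.biLipEquiv`). Write `G_i = z_i^(a_i+b_i) * conj
z_i^b_i`, let `P` be the perturbation, and let `κ_i` be a local inverse at `1` of `z ↦ z^(a_i+b_i) *
conj z^b_i`. Replacing `z_i` by `z_i * κ_i(1 + u_i)` multiplies `G_i` by `1 + u_i`, so it suffices
to solve `∑ G_i u_i = P`. Take `u_i = conj G_i * P / ∑ |G_j|^2`. The denominator is exactly `N^(2d)`
for the weighted gauge `N`. The weight hypothesis gives `P` order at least `d + r_1`, so `u_i` has
order `r_1`, and a derivative costs at most the largest weight `r_1`. Thus `u_i` tends to `0` with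
bounded derivative, which makes the map close to the identity (`nearId_of_gaugeBound`,
`exists_nearId_mixedPB`). In `w` the same scheme runs with the norm as gauge and the single function
`u = (p - Q) / Q`, where `Q = normForm e`; a high jet makes it small. For the topological
equivalence, a radial stretching of each `z_i` turns `z_i^a_i` into `G_i`. If some `a_i = 1`, the
resulting `g` is a translation along `z_i`, hence a submersion. -/

/-- `F` fixes `0`, and `F - id` is Lipschitz with constant `1/2` near `0`. -/
def NearId {E : Type*} [NormedAddCommGroup E] (F : E → E) : Prop :=
  F 0 = 0 ∧ ∃ s ∈ 𝓝 (0 : E), ∀ x ∈ s, ∀ y ∈ s, ‖F x - F y - (x - y)‖ ≤ 1 / 2 * ‖x - y‖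

theorem NearId.prodMap {E E' : Type*} [NormedAddCommGroup E] [NormedAddCommGroup E']
    {F : E → E} {F' : E' → E'} (h : NearId F) (h' : NearId F') : NearId (Prod.map F F') := by
  obtain ⟨h0, s, hs, H⟩ := h
  obtain ⟨h0', s', hs', H'⟩ := h'
  refine ⟨by simp [Prod.map, h0, h0'], s ×ˢ s', prod_mem_nhds hs hs', ?_⟩
  intro x hx y hy
  refine (Prod.norm_def _).trans_le (max_le ?_ ?_)
  · refine (H x.1 hx.1 y.1 hy.1).trans ?_
    gcongr
    exact norm_fst_le (x - y)
  · refine (H' x.2 hx.2 y.2 hy.2).trans ?_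
    gcongr
    exact norm_snd_le (x - y)

theorem NearId.biLipEquiv {E G : Type*} [NormedAddCommGroup E] [NormedSpace ℝ E] [CompleteSpace E]
    {F : E → E} (hF : NearId F) {f g : E → G} (hfg : ∀ᶠ x in 𝓝 0, g (F x) = f x) :
    BiLipEquiv f g := by
  obtain ⟨h0, s, hs, H⟩ := hF
  obtain ⟨t, ht, hto, ht0⟩ := mem_nhds_iff.1 (inter_mem hs hfg)
  have hA : ApproximatesLinearOn F ((ContinuousLinearEquiv.refl ℝ E : E ≃L[ℝ] E) : E →L[ℝ] E) t
      (1 / 2) := by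
    intro x hx y hy
    simpa using H x (ht hx).1 y (ht hy).1
  -- On the trivial space the identity has norm `0`, so that case (it occurs for `m = 0`) is
  -- separate.
  have hc : Subsingleton E ∨
      (1 / 2 : NNReal) < ‖((ContinuousLinearEquiv.refl ℝ E).symm : E →L[ℝ] E)‖₊⁻¹ := by
    rcases subsingleton_or_nontrivial E with h | h
    · exact Or.inl h
    · right
      have : ‖((ContinuousLinearEquiv.refl ℝ E).symm : E →L[ℝ] E)‖₊ = 1 := by
        ext
        exact ContinuousLinearMap.norm_id
      rw [this, inv_one]
      exact NNReal.half_lt_self one_ne_zero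
  set φ := hA.toOpenPartialHomeomorph F t hc hto
  have hφF : ∀ x, φ x = F x := fun x => rfl
  -- The map has Lipschitz constant `3/2` and its inverse `1/(1 - 1/2) = 2`; `2` serves both.
  refine ⟨φ, ht0, h0, fun x hx => (ht hx).2, 2, ?_, ?_⟩
  · refine LipschitzOnWith.of_dist_le_mul fun x hx y hy => ?_
    rw [dist_eq_norm, dist_eq_norm, hφF, hφF]
    have h1 := H x (ht hx).1 y (ht hy).1
    have h2 := norm_sub_norm_le (F x - F y) (x - y)
    have h3 := norm_nonneg (x - y)
    norm_num
    linarith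
  · refine LipschitzOnWith.of_dist_le_mul fun x hx y hy => ?_
    have hx' := φ.map_target hx
    have hy' := φ.map_target hy
    have h1 := H _ (ht hx').1 _ (ht hy').1
    rw [← hφF, ← hφF, φ.right_inv hx, φ.right_inv hy] at h1
    rw [dist_eq_norm, dist_eq_norm]
    have h2 := norm_sub_norm_le (φ.symm x - φ.symm y) (x - y)
    rw [norm_sub_rev (φ.symm x - φ.symm y)] at h2
    norm_num
    linarith

/-- A map that is differentiable with small derivative off the origin is Lipschitz near it. -/
theorem exists_lipschitz_of_punctured {E G : Type*} [NormedAddCommGroup E] [NormedSpace ℝ E]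
    [NormedAddCommGroup G] [NormedSpace ℝ G] {V : E → G} {c : ℝ} (hV0 : V 0 = 0)
    (h : ∀ᶠ z in 𝓝[≠] (0 : E), DifferentiableAt ℝ V z ∧ ‖fderiv ℝ V z‖ ≤ c ∧ ‖V z‖ ≤ c * ‖z‖) :
    ∃ s ∈ 𝓝 (0 : E), ∀ x ∈ s, ∀ y ∈ s, ‖V x - V y‖ ≤ c * ‖x - y‖ := by
  rw [eventually_nhdsWithin_iff] at h
  obtain ⟨ε, hε, hb⟩ := Metric.eventually_nhds_iff_ball.1 h
  refine ⟨Metric.ball 0 ε, Metric.ball_mem_nhds _ hε, fun x hx y hy => ?_⟩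
  have hV : ∀ z ∈ Metric.ball (0 : E) ε, ‖V z‖ ≤ c * ‖z‖ := by
    intro z hz
    by_cases h0 : z = 0
    · simp [h0, hV0]
    · exact (hb z hz h0).2.2
  -- The mean value inequality fails on a segment through `0`. There `‖x‖ + ‖y‖ = ‖x - y‖`, and the
  -- bound on `V` itself suffices.
  by_cases h0 : (0 : E) ∈ segment ℝ x y
  · have hd := dist_add_dist_of_mem_segment h0
    rw [dist_zero_right, dist_zero_left, dist_eq_norm] at hd
    calc ‖V x - V y‖ ≤ ‖V x‖ + ‖V y‖ := norm_sub_le _ _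
      _ ≤ c * ‖x‖ + c * ‖y‖ := add_le_add (hV x hx) (hV y hy)
      _ = c * ‖x - y‖ := by rw [← hd]; ring
  · have hsub : segment ℝ x y ⊆ Metric.ball 0 ε := (convex_ball _ _).segment_subset hx hy
    have hne : ∀ z ∈ segment ℝ x y, z ≠ 0 := fun z hz h => h0 (h ▸ hz)
    exact Convex.norm_image_sub_le_of_norm_fderiv_le (𝕜 := ℝ)
      (fun z hz => (hb z (hsub hz) (hne z hz)).1)
      (fun z hz => (hb z (hsub hz) (hne z hz)).2.1) (convex_segment x y)
      (right_mem_segment ℝ x y) (left_mem_segment ℝ x y)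

/-! ### Functions of given order with respect to a gauge -/

section Gauge

variable {E : Type*} [NormedAddCommGroup E]

/-- `N` is positive off the origin and tends to `0` there. -/
structure IsGauge (N : E → ℝ) : Prop where
  pos : ∀ᶠ z in 𝓝[≠] (0 : E), 0 < N z
  tendsto : Tendsto N (𝓝[≠] 0) (𝓝 0)

theorem IsGauge.eventually {N : E → ℝ} (hN : IsGauge N) :
    ∀ᶠ z in 𝓝[≠] (0 : E), 0 < N z ∧ N z ≤ 1 :=
  hN.pos.and (hN.tendsto.eventually_le_const one_pos)

variable [NormedSpace ℝ E]

/-- Near the origin `f` is of order at least `k` with respect to the gauge `N`, and a derivative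
lowers the order by at most `R`. -/
def GaugeBound (N : E → ℝ) (R k : ℕ) (f : E → ℂ) : Prop :=
  ∃ C : ℝ, 0 ≤ C ∧ ∀ᶠ z in 𝓝[≠] (0 : E), DifferentiableAt ℝ f z ∧ ‖f z‖ ≤ C * N z ^ k ∧
    ‖fderiv ℝ f z‖ * N z ^ R ≤ C * N z ^ k

variable {N : E → ℝ} {R k k' : ℕ} {f g : E → ℂ}

theorem GaugeBound.mono (hN : IsGauge N) (hf : GaugeBound N R k f) (hk : k' ≤ k) :
    GaugeBound N R k' f := by
  obtain ⟨C, hC, H⟩ := hf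
  refine ⟨C, hC, ?_⟩
  filter_upwards [H, hN.eventually] with z hz hNz
  have : N z ^ k ≤ N z ^ k' := pow_le_pow_of_le_one hNz.1.le hNz.2 hk
  have h2 : C * N z ^ k ≤ C * N z ^ k' := by gcongr
  exact ⟨hz.1, hz.2.1.trans h2, hz.2.2.trans h2⟩

theorem gaugeBound_const (c : ℂ) : GaugeBound N R 0 (fun _ => c) :=
  ⟨‖c‖, norm_nonneg c, Eventually.of_forall fun z => by simp⟩

theorem GaugeBound.add (hf : GaugeBound N R k f) (hg : GaugeBound N R k g) (hN : IsGauge N) :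
    GaugeBound N R k (fun z => f z + g z) := by
  obtain ⟨C, hC, H⟩ := hf
  obtain ⟨C', hC', H'⟩ := hg
  refine ⟨C + C', by positivity, ?_⟩
  filter_upwards [H, H', hN.eventually] with z hz hz' hNz
  have hp := hNz.1
  refine ⟨hz.1.add hz'.1, ?_, ?_⟩
  · linarith [norm_add_le (f z) (g z), hz.2.1, hz'.2.1]
  · rw [fderiv_fun_add hz.1 hz'.1]
    calc ‖fderiv ℝ f z + fderiv ℝ g z‖ * N z ^ R
        ≤ (‖fderiv ℝ f z‖ + ‖fderiv ℝ g z‖) * N z ^ R := by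
          gcongr; exact norm_add_le _ _
      _ ≤ _ := by linarith [hz.2.2, hz'.2.2]

theorem GaugeBound.mul (hf : GaugeBound N R k f) (hg : GaugeBound N R k' g) (hN : IsGauge N) :
    GaugeBound N R (k + k') (fun z => f z * g z) := by
  obtain ⟨C, hC, H⟩ := hf
  obtain ⟨C', hC', H'⟩ := hg
  refine ⟨2 * (C * C'), by positivity, ?_⟩
  filter_upwards [H, H', hN.eventually] with z hz hz' hNz
  have hp := hNz.1
  refine ⟨hz.1.mul hz'.1, ?_, ?_⟩
  · rw [norm_mul]
    calc ‖f z‖ * ‖g z‖ ≤ (C * N z ^ k) * (C' * N z ^ k') := by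
          gcongr; exacts [hz.2.1, hz'.2.1]
      _ ≤ 2 * ((C * N z ^ k) * (C' * N z ^ k')) := le_mul_of_one_le_left (by positivity) one_le_two
      _ = _ := by ring
  · rw [fderiv_fun_mul hz.1 hz'.1]
    calc ‖f z • fderiv ℝ g z + g z • fderiv ℝ f z‖ * N z ^ R
        ≤ (‖f z‖ * ‖fderiv ℝ g z‖ + ‖g z‖ * ‖fderiv ℝ f z‖) * N z ^ R := by
          gcongr
          refine (norm_add_le _ _).trans ?_
          rw [norm_smul, norm_smul]
      _ = ‖f z‖ * (‖fderiv ℝ g z‖ * N z ^ R) + ‖g z‖ * (‖fderiv ℝ f z‖ * N z ^ R) := by ring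
      _ ≤ (C * N z ^ k) * (C' * N z ^ k') + (C' * N z ^ k') * (C * N z ^ k) := by
          exact add_le_add (mul_le_mul hz.2.1 hz'.2.2 (by positivity) (by positivity))
            (mul_le_mul hz'.2.1 hz.2.2 (by positivity) (by positivity))
      _ = _ := by ring

theorem GaugeBound.pow (hf : GaugeBound N R k f) (hN : IsGauge N) (j : ℕ) :
    GaugeBound N R (j * k) (fun z => f z ^ j) := by
  induction j with
  | zero => simpa using gaugeBound_const (N := N) (R := R) (1 : ℂ)
  | succ j ih =>
    simp only [pow_succ, Nat.succ_mul]
    exact ih.mul hf hN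

theorem GaugeBound.sum {ι : Type*} (s : Finset ι) {f : ι → E → ℂ} (hN : IsGauge N)
    (hf : ∀ i ∈ s, GaugeBound N R k (f i)) : GaugeBound N R k (fun z => ∑ i ∈ s, f i z) := by
  classical
  induction s using Finset.induction_on with
  | empty => exact ⟨0, le_rfl, by simp⟩
  | insert i s hi ih =>
    simp only [Finset.sum_insert hi]
    exact (hf i (by simp)).add (ih fun j hj => hf j (by simp [hj])) hN

theorem GaugeBound.prod {ι : Type*} (s : Finset ι) {f : ι → E → ℂ} {k : ι → ℕ} (hN : IsGauge N)
    (hf : ∀ i ∈ s, GaugeBound N R (k i) (f i)) :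
    GaugeBound N R (∑ i ∈ s, k i) (fun z => ∏ i ∈ s, f i z) := by
  classical
  induction s using Finset.induction_on with
  | empty => simpa using gaugeBound_const (N := N) (R := R) (1 : ℂ)
  | insert i s hi ih =>
    simp only [Finset.prod_insert hi, Finset.sum_insert hi]
    exact (hf i (by simp)).mul (ih fun j hj => hf j (by simp [hj])) hN

theorem GaugeBound.conj (hf : GaugeBound N R k f) :
    GaugeBound N R k (fun z => conj (f z)) := by
  obtain ⟨C, hC, H⟩ := hf
  refine ⟨C, hC, ?_⟩
  filter_upwards [H] with z hz
  have hd : HasFDerivAt (fun z => (starRingEnd ℂ) (f z))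
      ((Complex.conjLIE.toContinuousLinearEquiv : ℂ →L[ℝ] ℂ).comp (fderiv ℝ f z)) z :=
    (Complex.conjLIE.toContinuousLinearEquiv : ℂ →L[ℝ] ℂ).hasFDerivAt.comp z hz.1.hasFDerivAt
  refine ⟨hd.differentiableAt, by simpa using hz.2.1, ?_⟩
  rw [hd.fderiv]
  have : ‖(Complex.conjLIE.toContinuousLinearEquiv : ℂ →L[ℝ] ℂ).comp (fderiv ℝ f z)‖ =
      ‖fderiv ℝ f z‖ := Complex.conjLIE.toLinearIsometry.norm_toContinuousLinearMap_comp
  rw [this]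
  exact hz.2.2

/-- Division by a function of order `k'` that is bounded below by a power of the gauge. -/
theorem GaugeBound.div {s t : ℕ} (hf : GaugeBound N R t f) (hg : GaugeBound N R k' g)
    (hN : IsGauge N) (hlow : ∀ᶠ z in 𝓝[≠] (0 : E), N z ^ s ≤ ‖g z‖) (hks : k' ≤ s)
    (ht : k + 2 * s ≤ t + k') : GaugeBound N R k (fun z => f z / g z) := by
  obtain ⟨C, hC, H⟩ := hf
  obtain ⟨C', hC', H'⟩ := hg
  refine ⟨C + C * C', by positivity, ?_⟩
  filter_upwards [H, H', hN.eventually, hlow] with z hz hz' hNz hl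
  have hp := hNz.1
  have hgpos : 0 < ‖g z‖ := (pow_pos hp s).trans_le hl
  have hg0 : g z ≠ 0 := norm_pos_iff.1 hgpos
  -- Both terms of the quotient rule need an exponent count: `df / g` needs `k + s ≤ t`, which
  -- follows from `ht` and `hks`; `f dg / g^2` needs `ht` itself.
  have h1 : N z ^ t ≤ N z ^ k * N z ^ s := by
    rw [← pow_add]; exact pow_le_pow_of_le_one hp.le hNz.2 (by omega)
  have h2 : N z ^ t * N z ^ k' ≤ N z ^ k * (N z ^ s * N z ^ s) := by
    rw [← pow_add, ← pow_add, ← pow_add]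
    exact pow_le_pow_of_le_one hp.le hNz.2 (by omega)
  have hA : ∀ x : ℝ, x ≤ C * N z ^ t → x * ‖g z‖⁻¹ ≤ C * N z ^ k := by
    intro x hx
    rw [← div_eq_mul_inv, div_le_iff₀ hgpos]
    calc x ≤ C * N z ^ t := hx
      _ ≤ C * (N z ^ k * N z ^ s) := by gcongr
      _ ≤ C * (N z ^ k * ‖g z‖) := by gcongr
      _ = _ := by ring
  have hd : HasFDerivAt (fun z => f z / g z)
      (f z • (-((g z ^ 2)⁻¹) • fderiv ℝ g z) + (g z)⁻¹ • fderiv ℝ f z) z := by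
    simp only [div_eq_mul_inv]
    refine hz.1.hasFDerivAt.mul ?_
    have := (hasDerivAt_inv hg0).comp_hasFDerivAt_of_eq (𝕜 := ℝ) z hz'.1.hasFDerivAt rfl
    rw [Function.comp_def] at this
    exact this
  refine ⟨hd.differentiableAt, ?_, ?_⟩
  · rw [norm_div, div_eq_mul_inv]
    refine (hA _ hz.2.1).trans ?_
    gcongr
    exact le_add_of_nonneg_right (by positivity)
  · rw [hd.fderiv]
    have hB : ‖f z‖ * (‖fderiv ℝ g z‖ * N z ^ R) * (‖g z‖ * ‖g z‖)⁻¹ ≤ C * C' * N z ^ k := by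
      rw [← div_eq_mul_inv, div_le_iff₀ (by positivity)]
      calc ‖f z‖ * (‖fderiv ℝ g z‖ * N z ^ R) ≤ (C * N z ^ t) * (C' * N z ^ k') := by
            exact mul_le_mul hz.2.1 hz'.2.2 (by positivity) (by positivity)
        _ = C * C' * (N z ^ t * N z ^ k') := by ring
        _ ≤ C * C' * (N z ^ k * (N z ^ s * N z ^ s)) := by gcongr
        _ ≤ C * C' * (N z ^ k * (‖g z‖ * ‖g z‖)) := by gcongr
        _ = _ := by ring
    calc ‖f z • (-((g z ^ 2)⁻¹) • fderiv ℝ g z) + (g z)⁻¹ • fderiv ℝ f z‖ * N z ^ R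
        ≤ (‖f z‖ * ((‖g z‖ * ‖g z‖)⁻¹ * ‖fderiv ℝ g z‖) + ‖g z‖⁻¹ * ‖fderiv ℝ f z‖) * N z ^ R := by
          gcongr
          refine (norm_add_le _ _).trans ?_
          simp only [norm_smul, norm_neg, norm_inv, norm_mul, sq]
          exact le_rfl
      _ = ‖f z‖ * (‖fderiv ℝ g z‖ * N z ^ R) * (‖g z‖ * ‖g z‖)⁻¹ +
          (‖fderiv ℝ f z‖ * N z ^ R) * ‖g z‖⁻¹ := by ring
      _ ≤ C * C' * N z ^ k + C * N z ^ k := add_le_add hB (hA _ hz.2.2)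
      _ = _ := by ring

theorem GaugeBound.tendsto_zero (hf : GaugeBound N R k f) (hN : IsGauge N) (hk : 1 ≤ k) :
    Tendsto f (𝓝[≠] 0) (𝓝 0) := by
  obtain ⟨C, hC, H⟩ := hf
  refine squeeze_zero_norm' (H.mono fun z hz => hz.2.1) ?_
  simpa [Nat.one_le_iff_ne_zero.1 hk] using (hN.tendsto.pow k).const_mul C

end Gauge

/-! ### Multiplicative perturbations of the identity -/

/-- The displacement `z_i * (κ_i(1 + u_i) - 1)` has derivative `(κ_i - 1) dz_i + z_i κ_i' du_i`. The
first term is small because `u_i` tends to `0`. In the second, order `R` with loss `R` only bounds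
`du_i`, and the factor `z_i` makes it small. Each gets a budget of `1/4`. -/
theorem nearId_of_gaugeBound {n : ℕ} {N : (Fin n → ℂ) → ℝ} {R : ℕ} (hN : IsGauge N) (hR : 1 ≤ R)
    {u : Fin n → (Fin n → ℂ) → ℂ} (hu : ∀ i, GaugeBound N R R (u i)) {κ : Fin n → ℂ → ℂ}
    (hκ1 : ∀ i, κ i 1 = 1) (hκ : ∀ i, ContDiffAt ℝ 1 (κ i) 1) :
    NearId (fun z i => z i * κ i (1 + u i z)) := by
  have key : ∀ i, ∃ s ∈ 𝓝 (0 : Fin n → ℂ), ∀ x ∈ s, ∀ y ∈ s,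
      ‖x i * (κ i (1 + u i x) - 1) - y i * (κ i (1 + u i y) - 1)‖ ≤ 1 / 2 * ‖x - y‖ := by
    intro i
    refine exists_lipschitz_of_punctured (V := fun z => z i * (κ i (1 + u i z) - 1))
      (by simp) ?_
    have hut := (hu i).tendsto_zero hN hR
    have hut1 : Tendsto (fun z => 1 + u i z) (𝓝[≠] 0) (𝓝 1) := by simpa using hut.const_add 1
    obtain ⟨C, hC, H⟩ := hu i
    have hκt : Tendsto (fun z => κ i (1 + u i z)) (𝓝[≠] 0) (𝓝 1) := by
      simpa [hκ1, Function.comp_def] using (hκ i).continuousAt.tendsto.comp hut1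
    have hκd : ∀ᶠ v in 𝓝 (1 : ℂ), DifferentiableAt ℝ (κ i) v := by
      filter_upwards [(hκ i).eventually (by simp)] with v hv
      exact hv.differentiableAt one_ne_zero
    have hκf : ∀ᶠ v in 𝓝 (1 : ℂ), ‖fderiv ℝ (κ i) v‖ ≤ ‖fderiv ℝ (κ i) 1‖ + 1 :=
      (((hκ i).fderiv_right (m := 0) (by simp)).continuousAt.norm).eventually_le_const
        (lt_add_one _)
    set K := ‖fderiv ℝ (κ i) 1‖ + 1 with hK
    have hKpos : 0 < K := by positivity
    have hsmall : ∀ᶠ z in 𝓝[≠] (0 : Fin n → ℂ), ‖z‖ * (K * C) ≤ 1 / 4 := by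
      have : Tendsto (fun z : Fin n → ℂ => ‖z‖ * (K * C)) (𝓝[≠] 0) (𝓝 0) := by
        have h : Continuous fun z : Fin n → ℂ => ‖z‖ * (K * C) := by fun_prop
        simpa using (h.tendsto 0).mono_left nhdsWithin_le_nhds
      exact this.eventually_le_const (by norm_num)
    have hκs : ∀ᶠ z in 𝓝[≠] (0 : Fin n → ℂ), ‖κ i (1 + u i z) - 1‖ ≤ 1 / 4 := by
      have : Tendsto (fun z => ‖κ i (1 + u i z) - 1‖) (𝓝[≠] 0) (𝓝 0) := by
        simpa using (hκt.sub_const 1).norm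
      exact this.eventually_le_const (by norm_num)
    filter_upwards [H, hut1.eventually hκd, hut1.eventually hκf, hsmall, hκs, hN.pos]
      with z hz hzd hzf hzs hzκ hNz
    have hdu : ‖fderiv ℝ (u i) z‖ ≤ C := le_of_mul_le_mul_right hz.2.2 (pow_pos hNz R)
    have hd1 : HasFDerivAt (fun z : Fin n → ℂ => z i)
        (ContinuousLinearMap.proj (R := ℝ) (φ := fun _ : Fin n => ℂ) i) z :=
      (ContinuousLinearMap.proj (R := ℝ) (φ := fun _ : Fin n => ℂ) i).hasFDerivAt
    have hd2 : HasFDerivAt (fun z => κ i (1 + u i z) - 1)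
        ((fderiv ℝ (κ i) (1 + u i z)).comp (fderiv ℝ (u i) z)) z :=
      (hzd.hasFDerivAt.comp z (hz.1.hasFDerivAt.const_add 1)).sub_const 1
    have hd := hd1.fun_mul hd2
    have hzi : ‖z i‖ ≤ ‖z‖ := norm_le_pi_norm z i
    have hproj : ‖ContinuousLinearMap.proj (R := ℝ) (φ := fun _ : Fin n => ℂ) i‖ ≤ 1 :=
      ContinuousLinearMap.opNorm_le_bound _ zero_le_one fun x => by
        simpa using norm_le_pi_norm x i
    refine ⟨hd.differentiableAt, ?_, ?_⟩
    · rw [hd.fderiv]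
      refine (norm_add_le _ _).trans ?_
      rw [norm_smul, norm_smul]
      have h1 : ‖(fderiv ℝ (κ i) (1 + u i z)).comp (fderiv ℝ (u i) z)‖ ≤ K * C :=
        (ContinuousLinearMap.opNorm_comp_le _ _).trans (by gcongr)
      calc _ ≤ ‖z‖ * (K * C) + 1 / 4 * 1 := by gcongr
        _ ≤ 1 / 2 := by linarith
    · rw [norm_mul]
      calc ‖z i‖ * ‖κ i (1 + u i z) - 1‖ ≤ ‖z‖ * (1 / 4) := by gcongr
        _ ≤ 1 / 2 * ‖z‖ := by linarith [norm_nonneg z]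
  choose s hs H using key
  refine ⟨by ext i; simp, ⋂ i, s i, by simpa [Filter.iInter_mem] using hs, ?_⟩
  intro x hx y hy
  rw [Set.mem_iInter] at hx hy
  refine (pi_norm_le_iff_of_nonneg (by positivity)).2 fun i => ?_
  refine le_of_eq_of_le (congrArg norm ?_) (H i x (hx i) y (hy i))
  simp only [Pi.sub_apply]
  ring

/-- A local inverse near `1` of `z ↦ z ^ (a + b) * conj z ^ b`. -/
theorem exists_mixedRoot (a b : ℕ) (ha : 1 ≤ a) : ∃ κ : ℂ → ℂ, κ 1 = 1 ∧ ContDiffAt ℝ 1 κ 1 ∧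
    ∀ᶠ v in 𝓝 (1 : ℂ), κ v ^ (a + b) * conj (κ v) ^ b = v := by
  have ha' : (a : ℝ) ≠ 0 := by positivity
  have hD : ((a : ℝ) + 2 * b) ≠ 0 := by positivity
  -- The target map multiplies arguments by `a` and raises moduli to the power `a + 2b`. The
  -- principal `a`-th root settles the argument; the real factor corrects the modulus to `‖v‖ ^
  -- (1/(a+2b))`.
  refine ⟨fun v => v ^ ((1 : ℂ) / a) * ((‖v‖ ^ ((1 : ℝ) / (a + 2 * b) - 1 / a) : ℝ) : ℂ),
    by simp, ?_, ?_⟩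
  · refine ContDiffAt.mul ?_ ?_
    · have : AnalyticAt ℂ (fun v : ℂ => v ^ ((1 : ℂ) / a)) 1 :=
        analyticAt_id.cpow analyticAt_const (by simp)
      exact this.contDiffAt.restrict_scalars ℝ
    · refine Complex.ofRealCLM.contDiff.contDiffAt.comp (1 : ℂ) ?_
      exact (contDiffAt_norm ℝ one_ne_zero).rpow_const_of_ne (by simp)
  · filter_upwards [isOpen_ne.mem_nhds (one_ne_zero : (1 : ℂ) ≠ 0)] with v hv
    have hvpos : 0 < ‖v‖ := norm_pos_iff.2 hv
    set c := v ^ ((1 : ℂ) / a) with hc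
    set t := ‖v‖ ^ ((1 : ℝ) / (a + 2 * b) - 1 / a) with ht
    have hca : c ^ a = v := by
      rw [hc, one_div]
      exact Complex.cpow_nat_inv_pow v (by omega)
    have hcn : ‖c‖ = ‖v‖ ^ ((1 : ℝ) / a) := by
      rw [hc]
      simpa only [Complex.ofReal_div, Complex.ofReal_one, Complex.ofReal_natCast] using
        Complex.norm_cpow_real v ((1 : ℝ) / a)
    have hcc : c * conj c = ((‖v‖ ^ ((2 : ℝ) / a) : ℝ) : ℂ) := by
      rw [Complex.mul_conj, Complex.normSq_eq_norm_sq, hcn, ← Real.rpow_natCast, ← Real.rpow_mul hvpos.le]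
      congr 2
      push_cast; ring
    have : (c * (t : ℂ)) ^ (a + b) * conj (c * (t : ℂ)) ^ b =
        c ^ a * ((c * conj c) ^ b * (t : ℂ) ^ (a + 2 * b)) := by
      rw [map_mul, Complex.conj_ofReal]
      ring
    rw [this, hca, hcc]
    have h1 : (‖v‖ ^ ((2 : ℝ) / a)) ^ b * t ^ (a + 2 * b) = 1 := by
      rw [ht, ← Real.rpow_natCast, ← Real.rpow_natCast, ← Real.rpow_mul hvpos.le,
        ← Real.rpow_mul hvpos.le, ← Real.rpow_add hvpos]
      have : (2 : ℝ) / a * (b : ℕ) + (1 / (a + 2 * b) - 1 / a) * ((a + 2 * b : ℕ) : ℝ) = 0 := by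
        push_cast
        field_simp
        ring
      rw [this, Real.rpow_zero]
    have h2 : ((‖v‖ ^ ((2 : ℝ) / a) : ℝ) : ℂ) ^ b * (t : ℂ) ^ (a + 2 * b) = 1 := by
      exact_mod_cast h1
    rw [h2, mul_one]

/-! ### The real summand -/

theorem isBigO_pow_of_iteratedFDeriv_eq_zero {E G : Type*} [NormedAddCommGroup E] [NormedSpace ℝ E]
    [NormedAddCommGroup G] [NormedSpace ℝ G] [CompleteSpace G] {V : E → G} (hV : AnalyticAt ℝ V 0)
    {j : ℕ} (h : ∀ k < j, iteratedFDeriv ℝ k V 0 = 0) : V =O[𝓝 0] fun x => ‖x‖ ^ j := by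
  obtain ⟨P, hP⟩ := hV
  obtain ⟨ρ, hρ⟩ := id hP
  have h0 : ∀ y, P.partialSum j y = 0 := by
    intro y
    refine Finset.sum_eq_zero fun k hk => ?_
    have := hρ.factorial_smul y k
    rw [h k (Finset.mem_range.1 hk), zero_apply, ← Nat.cast_smul_eq_nsmul ℝ] at this
    exact (smul_eq_zero.1 this).resolve_left (by exact_mod_cast k.factorial_ne_zero)
  simpa [h0] using hP.isBigO_sub_partialSum_pow j

theorem contDiff_normForm {m : ℕ} (e : Fin m → ℕ) {k : WithTop ℕ∞} :
    ContDiff ℝ k (normForm e) := by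
  unfold normForm
  refine ContDiff.sum fun i _ => ?_
  simp only [pow_mul]
  exact ((contDiff_norm_sq ℝ).comp (contDiff_apply ℝ ℂ i)).pow (e i)

/-- The coordinate of largest modulus carries the sup norm. Which one it is varies, so the exponent
is the sum, which dominates every `2 * e i`. -/
theorem pow_le_normForm {m : ℕ} (e : Fin m → ℕ) {w : Fin m → ℂ} (hw : w ≠ 0) (hw1 : ‖w‖ ≤ 1) :
    ‖w‖ ^ (2 * ∑ i, e i) ≤ normForm e w := by
  obtain ⟨i₀, -⟩ := Function.ne_iff.1 hw
  have : Nonempty (Fin m) := ⟨i₀⟩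
  obtain ⟨i, hi⟩ := Finite.exists_max fun i => ‖w i‖
  have hwi : ‖w‖ ≤ ‖w i‖ := (pi_norm_le_iff_of_nonneg (norm_nonneg _)).2 hi
  calc ‖w‖ ^ (2 * ∑ i, e i) ≤ ‖w‖ ^ (2 * e i) :=
        pow_le_pow_of_le_one (norm_nonneg _) hw1
          (Nat.mul_le_mul_left 2 (Finset.single_le_sum (fun _ _ => Nat.zero_le _) (Finset.mem_univ i)))
    _ ≤ ‖w i‖ ^ (2 * e i) := by gcongr
    _ ≤ normForm e w :=
        Finset.single_le_sum (f := fun i => ‖w i‖ ^ (2 * e i)) (fun _ _ => by positivity)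
          (Finset.mem_univ i)

theorem isGauge_norm {E : Type*} [NormedAddCommGroup E] : IsGauge (fun x : E => ‖x‖) where
  pos := eventually_nhdsWithin_of_forall fun _ hx => norm_pos_iff.2 hx
  tendsto := by
    simpa using ((continuous_norm (E := E)).tendsto 0).mono_left nhdsWithin_le_nhds

theorem norm_fderiv_ofReal_comp {E : Type*} [NormedAddCommGroup E] [NormedSpace ℝ E] {V : E → ℝ}
    {x : E} (h : DifferentiableAt ℝ V x) : DifferentiableAt ℝ (fun x => (V x : ℂ)) x ∧
      ‖fderiv ℝ (fun x => (V x : ℂ)) x‖ = ‖fderiv ℝ V x‖ := by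
  have hd : HasFDerivAt (fun x => (V x : ℂ)) (Complex.ofRealCLM.comp (fderiv ℝ V x)) x :=
    Complex.ofRealCLM.hasFDerivAt.comp x h.hasFDerivAt
  refine ⟨hd.differentiableAt, ?_⟩
  rw [hd.fderiv]
  exact Complex.ofRealLI.norm_toContinuousLinearMap_comp

/-- An analytic function with vanishing `l`-jet has order `l + 1` with respect to the norm. -/
theorem gaugeBound_of_jet_eq_zero {E : Type*} [NormedAddCommGroup E] [NormedSpace ℝ E] {V : E → ℝ}
    (hV : AnalyticAt ℝ V 0) {l : ℕ} (h : ∀ k ≤ l, iteratedFDeriv ℝ k V 0 = 0) :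
    GaugeBound (fun x : E => ‖x‖) 1 (l + 1) (fun x => (V x : ℂ)) := by
  have h1 := isBigO_pow_of_iteratedFDeriv_eq_zero hV (j := l + 1) fun k hk => h k (by omega)
  -- The derivative has vanishing `(l-1)`-jet, so it is `O(‖x‖^l)`; the loss `R = 1` restores order
  -- `l + 1`.
  have h2 := isBigO_pow_of_iteratedFDeriv_eq_zero hV.fderiv (j := l) fun k hk => by
    have := h (k + 1) (by omega)
    rw [iteratedFDeriv_succ_eq_comp_right, Function.comp_apply] at this
    exact (LinearIsometryEquiv.map_eq_zero_iff _).1 this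
  obtain ⟨C, hC, H⟩ := h1.exists_pos
  obtain ⟨C', hC', H'⟩ := h2.exists_pos
  refine ⟨C + C', by positivity, nhdsWithin_le_nhds ?_⟩
  filter_upwards [H.bound, H'.bound, hV.eventually_analyticAt] with x hx hx' hxa
  obtain ⟨hd, hn⟩ := norm_fderiv_ofReal_comp hxa.differentiableAt
  rw [norm_pow, norm_norm] at hx hx'
  refine ⟨hd, ?_, ?_⟩
  · rw [Complex.norm_real]
    refine hx.trans ?_
    gcongr
    linarith
  · rw [hn, pow_one]
    calc ‖fderiv ℝ V x‖ * ‖x‖ ≤ (C' * ‖x‖ ^ l) * ‖x‖ := by gcongr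
      _ = C' * ‖x‖ ^ (l + 1) := by ring
      _ ≤ _ := by gcongr; linarith

/-- Meant for the denominator `normForm e`: order `0` is enough there, at the cost of a larger `l`.
-/
theorem gaugeBound_of_analyticAt {E : Type*} [NormedAddCommGroup E] [NormedSpace ℝ E] {V : E → ℝ}
    (hV : AnalyticAt ℝ V 0) : GaugeBound (fun x : E => ‖x‖) 1 0 (fun x => (V x : ℂ)) := by
  have h1 : ∀ᶠ x in 𝓝 (0 : E), ‖V x‖ < ‖V 0‖ + 1 :=
    hV.continuousAt.norm.eventually_lt_const (lt_add_one _)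
  have h2 : ∀ᶠ x in 𝓝 (0 : E), ‖fderiv ℝ V x‖ < ‖fderiv ℝ V 0‖ + 1 :=
    hV.fderiv.continuousAt.norm.eventually_lt_const (lt_add_one _)
  refine ⟨(‖V 0‖ + 1) + (‖fderiv ℝ V 0‖ + 1), by positivity, nhdsWithin_le_nhds ?_⟩
  filter_upwards [h1, h2, hV.eventually_analyticAt, Metric.ball_mem_nhds (0 : E) one_pos]
    with x hx hx' hxa hx1
  obtain ⟨hd, hn⟩ := norm_fderiv_ofReal_comp hxa.differentiableAt
  rw [mem_ball_zero_iff] at hx1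
  have := norm_nonneg (V 0)
  have := norm_nonneg (fderiv ℝ V 0)
  refine ⟨hd, ?_, ?_⟩
  · rw [Complex.norm_real]
    linarith
  · rw [hn, pow_one]
    calc ‖fderiv ℝ V x‖ * ‖x‖ ≤ ‖fderiv ℝ V x‖ * 1 := by gcongr
      _ ≤ _ := by linarith

theorem exists_nearId_normForm {m : ℕ} {e : Fin m → ℕ} (he : ∀ i, 1 ≤ e i) {l : ℕ}
    (hl : 4 * ∑ i, e i ≤ l) {p : (Fin m → ℂ) → ℝ} (hp : AnalyticAt ℝ p 0)
    (hj : SameJet l p (normForm e)) :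
    ∃ F : (Fin m → ℂ) → (Fin m → ℂ), NearId F ∧ ∀ᶠ w in 𝓝 0, normForm e (F w) = p w := by
  have hN : IsGauge (fun w : Fin m → ℂ => ‖w‖) := isGauge_norm
  have hQ : AnalyticAt ℝ (normForm e) 0 :=
    (contDiff_normForm e (k := ω)).contDiffAt.analyticAt
  have hsub : ∀ k ≤ l, iteratedFDeriv ℝ k (fun w => p w - normForm e w) 0 = 0 := by
    intro k hk
    have := iteratedFDeriv_sub_apply (i := k) (hp.contDiffAt (n := k)) (hQ.contDiffAt (n := k))
    rw [hj k hk, sub_self] at this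
    exact this
  have h1 := gaugeBound_of_jet_eq_zero (hp.sub hQ) hsub
  have h2 := gaugeBound_of_analyticAt hQ
  have hlow : ∀ᶠ w in 𝓝[≠] (0 : Fin m → ℂ), ‖w‖ ^ (2 * ∑ i, e i) ≤ ‖(normForm e w : ℂ)‖ := by
    filter_upwards [hN.eventually, self_mem_nhdsWithin] with w hw hw0
    refine (pow_le_normForm e hw0 hw.2).trans ?_
    rw [Complex.norm_real]
    exact Real.le_norm_self _
  -- The count is `1 + 2 * (2 * ∑ e i) ≤ l + 1`.
  have hu := h1.div (k := 1) h2 hN hlow (by omega) (by omega)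
  choose κ hκ1 hκ hκe using fun i => exists_mixedRoot (2 * e i) 0 (by have := he i; omega)
  refine ⟨_, nearId_of_gaugeBound hN le_rfl (fun _ : Fin m => hu) hκ1 hκ, ?_⟩
  have ht := hu.tendsto_zero hN le_rfl
  have ht1 : Tendsto (fun w => 1 + ((p w - normForm e w : ℝ) : ℂ) / (normForm e w : ℂ))
      (𝓝[≠] 0) (𝓝 1) := by simpa using ht.const_add 1
  -- The multiplier `v = p / normForm e` is real; near `1` it is positive, so its norm is `p /
  -- normForm e` itself.
  have hre : ∀ᶠ v in 𝓝 (1 : ℂ), 0 < v.re :=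
    (Complex.continuous_re.tendsto 1).eventually_const_lt (by simp)
  have hall := eventually_all.2 fun i => ht1.eventually (hκe i)
  have key : ∀ᶠ w in 𝓝[≠] (0 : Fin m → ℂ), normForm e (fun i => w i * κ i (1 +
      ((p w - normForm e w : ℝ) : ℂ) / (normForm e w : ℂ))) = p w := by
    filter_upwards [hall, ht1.eventually hre, hN.eventually, self_mem_nhdsWithin]
      with w hw hwre hNw hw0
    have hpos : 0 < normForm e w :=
      (pow_pos hNw.1 _).trans_le (pow_le_normForm e hw0 hNw.2)
    set v : ℂ := 1 + ((p w - normForm e w : ℝ) : ℂ) / (normForm e w : ℂ) with hv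
    have hvr : v = ((p w / normForm e w : ℝ) : ℂ) := by
      have : (normForm e w : ℂ) ≠ 0 := by exact_mod_cast hpos.ne'
      rw [hv]
      push_cast
      field_simp
      ring
    have hvn : ‖v‖ = p w / normForm e w := by
      rw [hvr, Complex.ofReal_re] at hwre
      rw [hvr, Complex.norm_real, Real.norm_of_nonneg hwre.le]
    have hterm : ∀ i, ‖w i * κ i v‖ ^ (2 * e i) = ‖w i‖ ^ (2 * e i) * ‖v‖ := by
      intro i
      have := hw i
      simp only [add_zero, pow_zero, mul_one] at this
      rw [norm_mul, mul_pow, ← norm_pow (κ i v), this]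
    calc normForm e (fun i => w i * κ i v) = normForm e w * ‖v‖ := by
          simp only [normForm, hterm, Finset.sum_mul]
      _ = p w := by rw [hvn]; field_simp
  rw [eventually_nhdsWithin_iff] at key
  filter_upwards [key] with w hw
  by_cases h0 : w = 0
  · have hp0 : p 0 = normForm e 0 := by
      have := congrArg (fun T => T ![]) (hj 0 (Nat.zero_le _))
      simpa using this
    subst h0
    rw [hp0]
    congr 1
    ext i
    simp
  · exact hw h0

/-! ### The mixed summand -/

section Weighted

variable {n : ℕ}

/-- The weighted homogeneous gauge `(∑ |z_i|^(2 D_i))^(1/(2d))`. -/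
def weightGauge (D : Fin n → ℕ) (d : ℕ) (z : Fin n → ℂ) : ℝ :=
  (∑ i, ‖z i‖ ^ (2 * D i)) ^ ((2 * d : ℕ) : ℝ)⁻¹

theorem weightGauge_nonneg (D : Fin n → ℕ) (d : ℕ) (z : Fin n → ℂ) : 0 ≤ weightGauge D d z :=
  Real.rpow_nonneg (Finset.sum_nonneg fun _ _ => by positivity) _

theorem weightGauge_pow (D : Fin n → ℕ) {d : ℕ} (hd : d ≠ 0) (z : Fin n → ℂ) :
    weightGauge D d z ^ (2 * d) = ∑ i, ‖z i‖ ^ (2 * D i) :=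
  Real.rpow_inv_natCast_pow (Finset.sum_nonneg fun _ _ => by positivity) (by omega)

theorem isGauge_weightGauge {D : Fin n → ℕ} (hD : ∀ i, D i ≠ 0) {d : ℕ} (hd : d ≠ 0) :
    IsGauge (weightGauge D d) where
  pos := by
    filter_upwards [self_mem_nhdsWithin] with z hz
    obtain ⟨i, hi⟩ := Function.ne_iff.1 hz
    refine Real.rpow_pos_of_pos (Finset.sum_pos' (fun _ _ => by positivity) ⟨i, Finset.mem_univ i, ?_⟩) _
    exact pow_pos (norm_pos_iff.2 hi) _
  tendsto := by
    have hc : Continuous (weightGauge D d) :=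
      Continuous.rpow_const (by fun_prop) fun _ => Or.inr (by positivity)
    have h0 : weightGauge D d 0 = 0 := by
      have hs : ∑ i : Fin n, ‖(0 : Fin n → ℂ) i‖ ^ (2 * D i) = 0 :=
        Finset.sum_eq_zero fun i _ => by simp [hD i]
      rw [weightGauge, hs, Real.zero_rpow (by positivity)]
    simpa [h0] using (hc.tendsto 0).mono_left nhdsWithin_le_nhds

/-- After raising to the power `2 * D i`, one summand is compared with the whole sum, since `r i *
(2 * D i) = 2 * d`. -/
theorem norm_le_weightGauge_pow {D r : Fin n → ℕ} (hD : ∀ i, D i ≠ 0) {d : ℕ} (hd : d ≠ 0)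
    (hr : ∀ i, r i * D i = d) (z : Fin n → ℂ) (i : Fin n) : ‖z i‖ ≤ weightGauge D d z ^ r i := by
  have hN := weightGauge_nonneg D d z
  refine (pow_le_pow_iff_left₀ (norm_nonneg _) (by positivity)
    (mul_ne_zero two_ne_zero (hD i))).1 ?_
  have : r i * (2 * D i) = 2 * d := by rw [← hr i]; ring
  rw [← pow_mul, this, weightGauge_pow D hd]
  exact Finset.single_le_sum (f := fun i => ‖z i‖ ^ (2 * D i)) (fun _ _ => by positivity)
    (Finset.mem_univ i)

/-- The derivative of a coordinate is merely bounded, and `N ^ R ≤ N ^ r i` needs `r i ≤ R`: this is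
why the loss `R` must be at least the largest weight. -/
theorem gaugeBound_coord {D r : Fin n → ℕ} (hD : ∀ i, D i ≠ 0) {d : ℕ} (hd : d ≠ 0)
    (hr : ∀ i, r i * D i = d) {R : ℕ} (i : Fin n) (hR : r i ≤ R) :
    GaugeBound (weightGauge D d) R (r i) (fun z => z i) := by
  refine ⟨1, zero_le_one, ?_⟩
  filter_upwards [(isGauge_weightGauge hD hd).eventually] with z hz
  have hd1 : HasFDerivAt (fun z : Fin n → ℂ => z i)
      (ContinuousLinearMap.proj (R := ℝ) (φ := fun _ : Fin n => ℂ) i) z :=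
    (ContinuousLinearMap.proj (R := ℝ) (φ := fun _ : Fin n => ℂ) i).hasFDerivAt
  have hproj : ‖ContinuousLinearMap.proj (R := ℝ) (φ := fun _ : Fin n => ℂ) i‖ ≤ 1 :=
    ContinuousLinearMap.opNorm_le_bound _ zero_le_one fun x => by
      simpa using norm_le_pi_norm x i
  refine ⟨hd1.differentiableAt, by simpa using norm_le_weightGauge_pow hD hd hr z i, ?_⟩
  rw [hd1.fderiv]
  exact mul_le_mul hproj (pow_le_pow_of_le_one hz.1.le hz.2 hR) (pow_nonneg hz.1.le _) zero_le_one

theorem gaugeBound_evalAt {D r : Fin n → ℕ} (hD : ∀ i, D i ≠ 0) {d : ℕ} (hd : d ≠ 0)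
    (hr : ∀ i, r i * D i = d) {R : ℕ} (hR : ∀ i, r i ≤ R) {P : MixedPoly n} {k : ℕ}
    (hk : (k : ℕ∞) ≤ P.filtration r) : GaugeBound (weightGauge D d) R k P.evalAt := by
  have hN := isGauge_weightGauge hD hd
  have : P.evalAt = fun z => ∑ s ∈ P.support, P.coeff s *
      ((∏ i, z i ^ s (Sum.inl i)) * ∏ i, conj (z i) ^ s (Sum.inr i)) := by
    ext z
    simp [MixedPoly.evalAt, MvPolynomial.eval_eq', Fintype.prod_sum_type]
  rw [this]
  refine GaugeBound.sum _ hN fun s hs => ?_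
  have hks : k ≤ ∑ i, r i * (s (Sum.inl i) + s (Sum.inr i)) := by
    exact_mod_cast hk.trans (iInf₂_le s hs)
  refine GaugeBound.mono hN ((gaugeBound_const (P.coeff s)).mul
    ((GaugeBound.prod Finset.univ hN fun i _ =>
      (gaugeBound_coord hD hd hr i (hR i)).pow hN (s (Sum.inl i))).mul
    (GaugeBound.prod Finset.univ hN fun i _ =>
      (gaugeBound_coord hD hd hr i (hR i)).conj.pow hN (s (Sum.inr i))) hN) hN) ?_
  refine hks.trans (le_of_eq ?_)
  rw [zero_add, ← Finset.sum_add_distrib]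
  exact Finset.sum_congr rfl fun i _ => by ring

/-- A perturbation of order greater than `d` by at least the largest weight is absorbed by a
change of coordinates. -/
theorem exists_nearId_mixedPB {a b r : Fin n → ℕ} (ha : ∀ i, 1 ≤ a i) {d : ℕ} (hd : d ≠ 0)
    (hr : ∀ i, r i * (a i + 2 * b i) = d) {R : ℕ} (hR1 : 1 ≤ R) (hR : ∀ i, r i ≤ R)
    {P : (Fin n → ℂ) → ℂ} (hP0 : P 0 = 0)
    (hP : GaugeBound (weightGauge (fun i => a i + 2 * b i) d) R (d + R) P) :
    ∃ F : (Fin n → ℂ) → (Fin n → ℂ), NearId F ∧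
      ∀ᶠ z in 𝓝 0, mixedPB a b (F z) = mixedPB a b z + P z := by
  have hD : ∀ i, a i + 2 * b i ≠ 0 := fun i => by have := ha i; omega
  have hN := isGauge_weightGauge hD hd
  set N := weightGauge (fun i => a i + 2 * b i) d with hNdef
  set G : Fin n → (Fin n → ℂ) → ℂ := fun i z => z i ^ (a i + b i) * conj (z i) ^ b i with hG
  have hGb : ∀ i, GaugeBound N R d (G i) := by
    intro i
    have hc := gaugeBound_coord hD hd hr i (hR i)
    refine ((hc.pow hN (a i + b i)).mul (hc.conj.pow hN (b i)) hN).mono hN (le_of_eq ?_)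
    rw [← hr i]
    ring
  have hSb : GaugeBound N R (d + d) (fun z => ∑ i, G i z * conj (G i z)) :=
    GaugeBound.sum _ hN fun i _ => (hGb i).mul (hGb i).conj hN
  have hS : ∀ z, ∑ i, G i z * conj (G i z) = ((N z ^ (2 * d) : ℝ) : ℂ) := by
    intro z
    rw [hNdef, weightGauge_pow _ hd]
    push_cast
    refine Finset.sum_congr rfl fun i _ => ?_
    have : ‖G i z‖ = ‖z i‖ ^ (a i + 2 * b i) := by
      simp only [hG, norm_mul, norm_pow, RCLike.norm_conj]
      ring
    rw [Complex.mul_conj, Complex.normSq_eq_norm_sq, this]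
    push_cast
    ring
  have hlow : ∀ᶠ z in 𝓝[≠] (0 : Fin n → ℂ), N z ^ (2 * d) ≤ ‖∑ i, G i z * conj (G i z)‖ :=
    Eventually.of_forall fun z => by
      rw [hS, Complex.norm_real]
      exact Real.le_norm_self _
  -- The order is `d + (d + R) - 2d = R`, with nothing to spare.
  have hu : ∀ i, GaugeBound N R R
      (fun z => conj (G i z) * P z / ∑ j, G j z * conj (G j z)) := fun i =>
    ((hGb i).conj.mul hP hN).div hSb hN hlow (by omega) (by omega)
  choose κ hκ1 hκ hκe using fun i => exists_mixedRoot (a i) (b i) (ha i)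
  have hF := nearId_of_gaugeBound hN hR1 hu hκ1 hκ
  refine ⟨_, hF, ?_⟩
  have ht1 : ∀ i, Tendsto (fun z => 1 + conj (G i z) * P z / ∑ j, G j z * conj (G j z))
      (𝓝[≠] 0) (𝓝 1) := fun i => by
    simpa using ((hu i).tendsto_zero hN hR1).const_add 1
  have hall := eventually_all.2 fun i => (ht1 i).eventually (hκe i)
  have key : ∀ᶠ z in 𝓝[≠] (0 : Fin n → ℂ), mixedPB a b (fun i => z i * κ i (1 +
      conj (G i z) * P z / ∑ j, G j z * conj (G j z))) = mixedPB a b z + P z := by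
    filter_upwards [hall, hN.pos] with z hz hNz
    have hS0 : ∑ i, G i z * conj (G i z) ≠ 0 := by
      rw [hS]
      exact_mod_cast (pow_pos hNz _).ne'
    set S := ∑ i, G i z * conj (G i z) with hSdef
    have hterm : ∀ i, (z i * κ i (1 + conj (G i z) * P z / S)) ^ (a i + b i) *
        conj (z i * κ i (1 + conj (G i z) * P z / S)) ^ b i =
        G i z + G i z * conj (G i z) * (P z / S) := by
      intro i
      rw [map_mul (starRingEnd ℂ) (z i), mul_pow, mul_pow, mul_mul_mul_comm, hz i]
      change G i z * _ = _
      ring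
    simp only [mixedPB, hterm]
    rw [Finset.sum_add_distrib, ← Finset.sum_mul, ← hSdef, mul_div_cancel₀ _ hS0]
  rw [eventually_nhdsWithin_iff] at key
  filter_upwards [key] with z hz
  -- At the origin the quotient is a default value, but the factor `z i` kills it.
  by_cases h0 : z = 0
  · subst h0
    exact (congrArg (mixedPB a b) hF.1).trans (by rw [hP0, add_zero])
  · exact hz h0

end Weighted

theorem deformedPB_eq {n : ℕ} (a b : Fin n → ℕ) (q : Fin n → MixedPoly n) (z : Fin n → ℂ) :
    deformedPB a b q z = mixedPB a b z + ∑ i, z i ^ a i * (q i).evalAt z := by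
  simp only [deformedPB, mixedPB]
  rw [← Finset.sum_add_distrib]
  refine Finset.sum_congr rfl fun i _ => ?_
  have : (‖z i‖ : ℂ) ^ (2 * b i) = z i ^ b i * conj (z i) ^ b i := by
    rw [← mul_pow, Complex.mul_conj, Complex.normSq_eq_norm_sq, pow_mul]
    push_cast
    rfl
  rw [this]
  ring

theorem wdeg_ne_zero {n : ℕ} {a b : Fin n → ℕ} (ha : ∀ i, 1 ≤ a i) : wdeg a b ≠ 0 := by
  intro h
  obtain ⟨i, -, hi⟩ := Finset.lcm_eq_zero_iff.1 h
  have := ha i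
  omega

theorem weight_mul {n : ℕ} (a b : Fin n → ℕ) (i : Fin n) :
    weight a b i * (a i + 2 * b i) = wdeg a b :=
  Nat.div_mul_cancel (Finset.dvd_lcm (Finset.mem_univ i))

/-- The factor `z_i^a_i` has order `a_i r_i ≥ r_i ≥ r_n`, since weights decrease with `i`. This
compensates the `-r_n` in the hypothesis and leaves order `d + r_1`, with `r_1` the largest weight.
-/
theorem exists_nearId_deformedPB {n : ℕ} {a b : Fin (n + 1) → ℕ} (ha : ∀ i, 1 ≤ a i)
    (hmono : Monotone fun i => a i + 2 * b i) {q : Fin (n + 1) → MixedPoly (n + 1)}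
    (hq : ∀ i, ((wdeg a b - weight a b (Fin.last n) + weight a b 0 : ℕ) : ℕ∞) ≤
      (q i).filtration (weight a b)) :
    ∃ F : (Fin (n + 1) → ℂ) → (Fin (n + 1) → ℂ), NearId F ∧
      ∀ᶠ z in 𝓝 0, mixedPB a b (F z) = deformedPB a b q z := by
  have hd := wdeg_ne_zero (b := b) ha
  have hD : ∀ i, a i + 2 * b i ≠ 0 := fun i => by have := ha i; omega
  have hr := weight_mul a b
  have hanti : ∀ i j, i ≤ j → weight a b j ≤ weight a b i := fun i j hij =>
    Nat.div_le_div_left (hmono hij) (Nat.pos_of_ne_zero (hD i))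
  have hR : ∀ i, weight a b i ≤ weight a b 0 := fun i => hanti 0 i (Fin.zero_le i)
  have hR1 : 1 ≤ weight a b 0 := Nat.one_le_iff_ne_zero.2 fun h => hd (by rw [← hr 0, h, zero_mul])
  have hN := isGauge_weightGauge hD hd
  have hP : GaugeBound (weightGauge (fun i => a i + 2 * b i) (wdeg a b)) (weight a b 0)
      (wdeg a b + weight a b 0) (fun z => ∑ i, z i ^ a i * (q i).evalAt z) := by
    refine GaugeBound.sum _ hN fun i _ => ?_
    refine (((gaugeBound_coord hD hd hr i (hR i)).pow hN (a i)).mul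
      (gaugeBound_evalAt hD hd hr hR (hq i)) hN).mono hN ?_
    have h1 : weight a b (Fin.last n) ≤ weight a b i := hanti i _ (Fin.le_last i)
    have h2 : weight a b i ≤ a i * weight a b i := Nat.le_mul_of_pos_left _ (ha i)
    omega
  obtain ⟨F, hF, h⟩ := exists_nearId_mixedPB ha hd hr hR1 hR
    (by simp [fun i => Nat.one_le_iff_ne_zero.1 (ha i)]) hP
  exact ⟨F, hF, h.mono fun z hz => by rw [hz, deformedPB_eq]⟩

/-! ### Topological equivalences -/

theorem TopEquiv.trans {E G : Type*} [TopologicalSpace E] [Zero E] {f g h : E → G}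
    (hfg : TopEquiv f g) (hgh : TopEquiv g h) : TopEquiv f h := by
  obtain ⟨φ, h0, hφ0, H⟩ := hfg
  obtain ⟨ψ, h0', hψ0, H'⟩ := hgh
  refine ⟨φ.trans ψ, ?_, by simp [hφ0, hψ0], fun x hx => ?_⟩
  · simp [h0, hφ0, h0']
  · rw [OpenPartialHomeomorph.trans_source] at hx
    rw [OpenPartialHomeomorph.coe_trans, Function.comp_apply, H' _ hx.2, H _ hx.1]

theorem BiLipEquiv.topEquiv {E G : Type*} [PseudoEMetricSpace E] [Zero E] {f g : E → G}
    (h : BiLipEquiv f g) : TopEquiv f g := by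
  obtain ⟨φ, h0, hφ0, H, -⟩ := h
  exact ⟨φ, h0, hφ0, H⟩

/-- Radial stretching `z ↦ z |z| ^ (s - 1)`. -/
def radialStretch (s : ℝ) (z : ℂ) : ℂ := z * ((‖z‖ ^ (s - 1) : ℝ) : ℂ)

theorem norm_radialStretch {s : ℝ} (hs : 0 < s) (z : ℂ) : ‖radialStretch s z‖ = ‖z‖ ^ s := by
  rcases eq_or_ne z 0 with rfl | hz
  · simp [radialStretch, Real.zero_rpow hs.ne']
  · have hz' : 0 < ‖z‖ := norm_pos_iff.2 hz
    rw [radialStretch, norm_mul, Complex.norm_real, Real.norm_of_nonneg (by positivity),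
      Real.rpow_sub_one hz'.ne']
    field_simp

theorem radialStretch_radialStretch {s t : ℝ} (hs : 0 < s) (hst : s * t = 1) (z : ℂ) :
    radialStretch t (radialStretch s z) = z := by
  rcases eq_or_ne z 0 with rfl | hz
  · simp [radialStretch]
  · have hz' : 0 < ‖z‖ := norm_pos_iff.2 hz
    rw [radialStretch, norm_radialStretch hs, radialStretch, mul_assoc, ← Complex.ofReal_mul,
      ← Real.rpow_mul hz'.le, ← Real.rpow_add hz']
    have : s - 1 + s * (t - 1) = 0 := by linarith
    rw [this, Real.rpow_zero, Complex.ofReal_one, mul_one]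

theorem continuous_radialStretch {s : ℝ} (hs : 0 < s) : Continuous (radialStretch s) := by
  rw [continuous_iff_continuousAt]
  intro z
  rcases eq_or_ne z 0 with rfl | hz
  · have h0 : radialStretch s 0 = 0 := by simp [radialStretch]
    rw [ContinuousAt, h0]
    -- For `s < 1`, the case of the inverse stretching, the real factor blows up at `0`, but the
    -- norm is still `‖z‖ ^ s`.
    refine squeeze_zero_norm (fun z => (norm_radialStretch hs z).le) ?_
    have : Continuous fun z : ℂ => ‖z‖ ^ s :=
      continuous_norm.rpow_const fun _ => Or.inr hs.le
    simpa [Real.zero_rpow hs.ne'] using this.tendsto 0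
  · refine continuousAt_id.mul (Complex.continuous_ofReal.continuousAt.comp ?_)
    exact continuous_norm.continuousAt.rpow_const (Or.inl (norm_ne_zero_iff.2 hz))

/-- Radial stretching as a homeomorphism. -/
def radialHomeomorph (s : ℝ) (hs : 0 < s) : ℂ ≃ₜ ℂ where
  toFun := radialStretch s
  invFun := radialStretch s⁻¹
  left_inv := radialStretch_radialStretch hs (mul_inv_cancel₀ hs.ne')
  right_inv := radialStretch_radialStretch (inv_pos.2 hs) (inv_mul_cancel₀ hs.ne')
  continuous_toFun := continuous_radialStretch hs
  continuous_invFun := continuous_radialStretch (inv_pos.2 hs)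

/-- Stretching keeps the argument, and both sides have argument `a * arg z`; the exponent is chosen
so that the moduli agree, `a * s = a + 2b`. -/
theorem radialStretch_pow {a : ℕ} (ha : 1 ≤ a) (b : ℕ) (z : ℂ) :
    radialStretch (((a + 2 * b : ℕ) : ℝ) / a) z ^ a = z ^ (a + b) * conj z ^ b := by
  have ha' : (a : ℝ) ≠ 0 := by positivity
  have h1 : (‖z‖ ^ (((a + 2 * b : ℕ) : ℝ) / a - 1)) ^ a = ‖z‖ ^ (2 * b) := by
    rw [← Real.rpow_natCast, ← Real.rpow_mul (norm_nonneg z), ← Real.rpow_natCast]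
    congr 1
    push_cast
    field_simp
    ring
  have h2 : ((‖z‖ ^ (2 * b) : ℝ) : ℂ) = z ^ b * conj z ^ b := by
    rw [← mul_pow, Complex.mul_conj, Complex.normSq_eq_norm_sq, pow_mul]
    push_cast
    rfl
  rw [radialStretch, mul_pow, ← Complex.ofReal_pow, h1, h2]
  ring

theorem topEquiv_mixedPB_phamBrieskorn {m n : ℕ} (F : (Fin m → ℂ) → ℝ) {a : Fin n → ℕ}
    (ha : ∀ i, 1 ≤ a i) (b : Fin n → ℕ) :
    TopEquiv (directSum F (mixedPB a b)) (directSum F (phamBrieskorn a)) := by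
  have hpos : ∀ i, 0 < ((a i + 2 * b i : ℕ) : ℝ) / a i := fun i => by
    have h1 : 0 < a i := ha i
    positivity
  refine ⟨((Homeomorph.refl (Fin m → ℂ)).prodCongr (Homeomorph.piCongrRight fun i =>
    radialHomeomorph _ (hpos i))).toOpenPartialHomeomorph, by simp, ?_, fun x _ => ?_⟩
  · refine Prod.ext rfl (funext fun i => ?_)
    change radialStretch _ 0 = 0
    simp [radialStretch]
  · change (F x.1 : ℂ) + ∑ i, radialStretch _ (x.2 i) ^ a i = _
    simp only [radialStretch_pow (ha _)]
    rfl

theorem contDiff_directSum_phamBrieskorn {m n : ℕ} (e : Fin m → ℕ) (a : Fin n → ℕ) :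
    ContDiff ℝ ∞ (directSum (normForm e) (phamBrieskorn a)) := by
  unfold directSum phamBrieskorn
  refine ContDiff.add (Complex.ofRealCLM.contDiff.comp ((contDiff_normForm e).comp contDiff_fst)) ?_
  exact ContDiff.sum fun i _ => ((contDiff_apply ℝ ℂ i).comp contDiff_snd).pow (a i)

/-- Along the inclusion `ι` of the `i`-th coordinate the function is `t ↦ const + t`, so by the
chain rule `ι` is a right inverse of the derivative. -/
theorem surjective_fderiv_directSum_phamBrieskorn {m n : ℕ} (e : Fin m → ℕ) {a : Fin n → ℕ}
    {i : Fin n} (hi : a i = 1) (x : (Fin m → ℂ) × (Fin n → ℂ)) :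
    Function.Surjective (fderiv ℝ (directSum (normForm e) (phamBrieskorn a)) x) := by
  intro c
  set ι : ℂ →L[ℝ] (Fin m → ℂ) × (Fin n → ℂ) := (ContinuousLinearMap.inr ℝ _ _).comp
    (ContinuousLinearMap.single ℝ (fun _ : Fin n => ℂ) i) with hι
  have hline : ∀ t : ℂ, directSum (normForm e) (phamBrieskorn a) (x + ι t) =
      directSum (normForm e) (phamBrieskorn a) x + t := by
    intro t
    have h1 : (x + ι t).1 = x.1 := by simp [hι]
    have h2 : (x + ι t).2 = x.2 + Pi.single i t := by simp [hι]
    have h3 : phamBrieskorn a (x.2 + Pi.single i t) - phamBrieskorn a x.2 = t := by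
      rw [phamBrieskorn, phamBrieskorn, ← Finset.sum_sub_distrib, Finset.sum_eq_single i]
      · simp [hi]
      · intro j _ hj
        simp [hj]
      · simp
    rw [directSum, directSum, h1, h2]
    linear_combination h3
  have hg := ((contDiff_directSum_phamBrieskorn e a).differentiable (by simp) x).hasFDerivAt
  have hx : x = x + ι 0 := by simp
  have hl : HasFDerivAt (fun t : ℂ => x + ι t) ι 0 := ι.hasFDerivAt.const_add x
  nth_rw 2 [hx] at hg
  have hc := hg.comp (0 : ℂ) hl
  have hc' : HasFDerivAt (directSum (normForm e) (phamBrieskorn a) ∘ fun t : ℂ => x + ι t)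
      (ContinuousLinearMap.id ℝ ℂ) 0 := by
    have : (directSum (normForm e) (phamBrieskorn a) ∘ fun t : ℂ => x + ι t) =
        fun t => directSum (normForm e) (phamBrieskorn a) x + t := funext hline
    rw [this]
    exact (hasFDerivAt_id (0 : ℂ)).const_add _
  exact ⟨ι c, by simpa using congrArg (fun T : ℂ →L[ℝ] ℂ => T c) (hc.unique hc')⟩

end MixedGerm

end

open MixedGerm in
theorem mainTheorem7 (m : ℕ) (e : Fin m → ℕ) (he : ∀ i, 1 ≤ e i) :
    ∃ L : ℕ, ∀ l : ℕ, L ≤ l → m < l →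
      ∀ p : (Fin m → ℂ) → ℝ, AnalyticAt ℝ p 0 → SameJet l p (normForm e) →
      ∀ (n : ℕ) (a b : Fin (n + 1) → ℕ), (∀ i, 1 ≤ a i) →
        Monotone (fun i => a i + 2 * b i) →
      ∀ q : Fin (n + 1) → MixedPoly (n + 1), (∀ i, (q i).IsReal) →
        (∀ i, ((wdeg a b - weight a b (Fin.last n) + weight a b 0 : ℕ) : ℕ∞) ≤
          (q i).filtration (weight a b)) →
      BiLipEquiv (directSum p (deformedPB a b q)) (directSum (normForm e) (mixedPB a b)) ∧
      TopEquiv (directSum (normForm e) (mixedPB a b))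
        (directSum (normForm e) (phamBrieskorn a)) ∧
      ((∃ i, a i = 1) → IsTopSubmersion (directSum p (deformedPB a b q))) := by
  -- Twice the exponent in `pow_le_normForm`, because the quotient rule divides by the square of
  -- `normForm e`.
  refine ⟨4 * ∑ i, e i, fun l hl _ p hp hj n a b ha hmono q _ hq => ?_⟩
  obtain ⟨F, hF, hFp⟩ := exists_nearId_normForm he hl hp hj
  obtain ⟨G, hG, hGq⟩ := exists_nearId_deformedPB ha hmono hq
  have h1 : BiLipEquiv (directSum p (deformedPB a b q))
      (directSum (normForm e) (mixedPB a b)) := by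
    refine (hF.prodMap hG).biLipEquiv ?_
    rw [← Prod.mk_zero_zero, nhds_prod_eq]
    filter_upwards [hFp.prod_mk hGq] with x hx
    simp only [directSum, Prod.map_fst, Prod.map_snd, hx.1, hx.2]
  have h2 := topEquiv_mixedPB_phamBrieskorn (normForm e) ha b
  refine ⟨h1, h2, fun ⟨i, hi⟩ => ⟨_, h1.topEquiv.trans h2, Set.univ, isOpen_univ, trivial,
    (contDiff_directSum_phamBrieskorn e a).contDiffOn, fun x _ =>
      surjective_fderiv_directSum_phamBrieskorn e hi x⟩⟩
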